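/- Let $X$ be a complex Banach space, $T$ a bounded linear operator on $X$, and $T^*$ its adjoint on the dual space $X^*$. Definitions. A bounded operator $S$ on a complex Banach space $Y$ has the single valued extension property (SVEP) if for every open $U\subseteq\mathbb{C}$ the only analytic function $f:U\to Y$ with $(S-zI)f(z)=0$ for all $z\in U$ is $f\equiv 0$. $S$ is semi-regular if its range $R(S)$ is closed and its null space satisfies $N(S)\subseteq\bigcap_{n\ge 0}R(S^n)$; it is quasinilpotent if its spectral radius is $0$. $S$ is pseudo-Fredholm (admits a generalized Kato decomposition) if $Y=M\oplus N$ for closed $S$-invariant subspaces $M,N$ such that $S|_M$ is semi-regular and $S|_N$ is quasinilpotent. $S$ is generalized Drazin invertible if $0$ is not an accumulation point of its spectrum $\sigma(S)$. Put $$\sigma_{gK}(T)=\{\lambda\in\mathbb{C}: T-\lambda I \text{ is not pseudo-Fredholm}\},\qquad \sigma_{gD}(T)=\{\lambda\in\mathbb{C}: T-\lambda I \text{ is not generalized Drazin invertible}\}.$$ $T$ is decomposable if for all open $U_1,U_2\subseteq\mathbb{C}$ with $U_1\cup U_2=\mathbb{C}$ there are closed $T$-invariant subspaces $X_1,X_2$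 of $X$ with $X_1+X_2=X$ and $\sigma(T|_{X_k})\subseteq U_k$ for $k=1,2$. Statement. If $T$ and $T^*$ both have the SVEP, then $\sigma_{gD}(T)=\sigma_{gK}(T)$. In particular, if $T$ is decomposable, then $\sigma_{gD}(T)=\sigma_{gK}(T)$. -/

import Mathlib

open Topology Filter

namespace BanachOp

variable {X : Type*} [NormedAddCommGroup X] [NormedSpace ℂ X]

/-- The Banach space adjoint `T* : X* → X*`, `φ ↦ φ ∘ T`, on the topological dual of `X`. -/
noncomputable def adj (T : X →L[ℂ] X) : StrongDual ℂ X →L[ℂ] StrongDual ℂ X :=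
  ContinuousLinearMap.precomp ℂ T

theorem adj_apply (T : X →L[ℂ] X) (φ : StrongDual ℂ X) (x : X) : adj T φ x = φ (T x) := rfl

/-- `T` has the single valued extension property (at every point `z₀` of the plane): for every
open neighbourhood `U` of `z₀`, the only analytic `f : U → X` with `(T - z) f(z) = 0` on `U` is
the zero function on `U`. -/
def HasSVEP (T : X →L[ℂ] X) : Prop :=
  ∀ z₀ : ℂ, ∀ U : Set ℂ, IsOpen U → z₀ ∈ U → ∀ f : ℂ → X, AnalyticOnNhd ℂ f U →
    (∀ z ∈ U, (T - z • ContinuousLinearMap.id ℂ X) (f z) = 0) → ∀ z ∈ U, f z = 0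

/-- `T` is semi-regular (a Kato operator): `R(T)` is closed and `N(T) ⊆ ⋂ n, R(T ^ n)`. -/
def IsSemiRegular (T : X →L[ℂ] X) : Prop :=
  IsClosed (Set.range T) ∧ ∀ x, T x = 0 → ∀ n : ℕ, x ∈ Set.range (T ^ n)

/-- `T` is quasinilpotent: its spectral radius is zero. -/
def IsQuasinilpotent (T : X →L[ℂ] X) : Prop :=
  spectralRadius ℂ T = 0

/-- `T` is pseudo-Fredholm, i.e. admits a generalized Kato decomposition: `X = M ⊕ N` with `M`, `N`
closed and `T`-invariant, `T|M` semi-regular and `T|N` quasinilpotent. -/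
def IsPseudoFredholm (T : X →L[ℂ] X) : Prop :=
  ∃ (M N : Submodule ℂ X) (hM : ∀ x ∈ M, T x ∈ M) (hN : ∀ x ∈ N, T x ∈ N),
    IsClosed (M : Set X) ∧ IsClosed (N : Set X) ∧ IsCompl M N ∧
      IsSemiRegular (T.restrict hM) ∧ IsQuasinilpotent (T.restrict hN)

/-- The generalized Kato (pseudo-Fredholm) spectrum of `T`. -/
def gKSpectrum (T : X →L[ℂ] X) : Set ℂ :=
  {z | ¬ IsPseudoFredholm (T - z • ContinuousLinearMap.id ℂ X)}

/-- `T` is generalized Drazin invertible: `0` is not an accumulation point of the spectrum. -/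
def IsGenDrazinInvertible (T : X →L[ℂ] X) : Prop :=
  ¬ AccPt (0 : ℂ) (𝓟 (spectrum ℂ T))

/-- The generalized Drazin spectrum of `T`. -/
def gDSpectrum (T : X →L[ℂ] X) : Set ℂ :=
  {z | ¬ IsGenDrazinInvertible (T - z • ContinuousLinearMap.id ℂ X)}

/-- `T` is decomposable: for every open cover `U₁ ∪ U₂` of the plane there are closed `T`-invariant
subspaces `X₁`, `X₂` with `X₁ + X₂ = X` and `σ(T|Xₖ) ⊆ Uₖ`. -/
def IsDecomposable (T : X →L[ℂ] X) : Prop :=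
  ∀ U₁ U₂ : Set ℂ, IsOpen U₁ → IsOpen U₂ → U₁ ∪ U₂ = Set.univ →
    ∃ (X₁ X₂ : Submodule ℂ X) (h₁ : ∀ x ∈ X₁, T x ∈ X₁) (h₂ : ∀ x ∈ X₂, T x ∈ X₂),
      IsClosed (X₁ : Set X) ∧ IsClosed (X₂ : Set X) ∧ X₁ ⊔ X₂ = ⊤ ∧
        spectrum ℂ (T.restrict h₁) ⊆ U₁ ∧ spectrum ℂ (T.restrict h₂) ⊆ U₂

end BanachOp

/-!
The SVEP localizes to points, and at `0` it interacts with semi-regularity: a kernel vector of a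
semi-regular operator starts a backward orbit `T uₙ₊₁ = uₙ` of geometric growth, and
`z ↦ ∑ zⁿ uₙ` is then a germ of eigenvectors. Hence a semi-regular operator with the SVEP at `0` is
injective, and if its adjoint also has the SVEP at `0` it is bijective. In a generalized Kato
decomposition this makes the semi-regular part invertible, so `0` is at most an isolated point of
the spectrum. Conversely, if `0` is not an accumulation point of the spectrum, the Riesz projection
over a small circle splits `T` into an invertible and a quasinilpotent part, while `T - z` and its
adjoint are invertible for small `z ≠ 0`, which forces the SVEP at `0`.

For decomposable `T`, cover the plane by `{c}ᶜ` and a small disc around `c`. On the corresponding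
sum `X = X₁ + X₂`, an eigenvector germ of `T*` at `c` vanishes at `c` on `X₁` and vanishes outside
the disc, hence by the identity theorem everywhere, on `X₂`. An eigenvector germ of `T` is treated
in the same way in `X ⧸ X₁`. There the induced operator is only seen to be surjective off the disc;
it is invertible because a surjective operator is never on the boundary of its spectrum.
-/

namespace BanachOp

section LocalSVEP

variable {Y Z : Type*} [NormedAddCommGroup Y] [NormedSpace ℂ Y] [NormedAddCommGroup Z]
  [NormedSpace ℂ Z]

theorem sub_smul_id_apply {E : Type*} [SeminormedAddCommGroup E] [NormedSpace ℂ E] (T : E →L[ℂ] E)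
    (z : ℂ) (x : E) : (T - z • ContinuousLinearMap.id ℂ E) x = T x - z • x := by
  simp

theorem notMem_spectrum_iff_bijective [CompleteSpace Y] (T : Y →L[ℂ] Y) (z : ℂ) :
    z ∉ spectrum ℂ T ↔ Function.Bijective (T - z • ContinuousLinearMap.id ℂ Y) := by
  rw [spectrum.notMem_iff, ← ContinuousLinearMap.isUnit_iff_bijective, ← IsUnit.neg_iff, neg_sub]
  rfl

theorem adj_sub_smul_id (T : Y →L[ℂ] Y) (z : ℂ) :
    adj (T - z • ContinuousLinearMap.id ℂ Y) =
      adj T - z • ContinuousLinearMap.id ℂ (StrongDual ℂ Y) := by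
  ext φ x
  simp [adj_apply]

/-- The single valued extension property localized at `z₀`: the only analytic germ `f` at `z₀` with
`(T - z) f(z) = 0` is the zero germ. -/
def HasSVEPAt (T : Y →L[ℂ] Y) (z₀ : ℂ) : Prop :=
  ∀ f : ℂ → Y, AnalyticAt ℂ f z₀ → (∀ᶠ z in 𝓝 z₀, T (f z) = z • f z) → f =ᶠ[𝓝 z₀] 0

theorem HasSVEP.hasSVEPAt [CompleteSpace Y] {T : Y →L[ℂ] Y} (hT : HasSVEP T) (z₀ : ℂ) :
    HasSVEPAt T z₀ := by
  intro f hf hTf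
  obtain ⟨U, hU, hUo, hz₀⟩ := eventually_nhds_iff.1 (hf.eventually_analyticAt.and hTf)
  filter_upwards [hUo.mem_nhds hz₀] with z hz
  refine hT z₀ U hUo hz₀ f (fun w hw => (hU w hw).1) (fun w hw => ?_) z hz
  rw [sub_smul_id_apply, (hU w hw).2, sub_self]

theorem HasSVEPAt.sub_smul_id {T : Y →L[ℂ] Y} {z₀ w : ℂ} (hT : HasSVEPAt T (z₀ + w)) :
    HasSVEPAt (T - w • ContinuousLinearMap.id ℂ Y) z₀ := by
  intro f hf hTf
  have hshift : f ∘ (· - w) =ᶠ[𝓝 (z₀ + w)] 0 := by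
    refine hT _ (AnalyticAt.comp (by simpa using hf) (by fun_prop)) ?_
    have htendsto : Tendsto (· - w) (𝓝 (z₀ + w)) (𝓝 z₀) :=
      Continuous.tendsto' (by fun_prop) _ _ (by simp)
    filter_upwards [htendsto.eventually hTf] with z hz
    rw [sub_smul_id_apply, sub_smul, sub_left_inj] at hz
    exact hz
  have hadd : Tendsto (· + w) (𝓝 z₀) (𝓝 (z₀ + w)) := (continuous_add_const w).tendsto z₀
  filter_upwards [hadd.eventually hshift] with z hz
  simpa using hz

theorem hasSVEPAt_sub_smul_id_iff {T : Y →L[ℂ] Y} {z₀ w : ℂ} :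
    HasSVEPAt (T - w • ContinuousLinearMap.id ℂ Y) z₀ ↔ HasSVEPAt T (z₀ + w) := by
  refine ⟨fun h => ?_, HasSVEPAt.sub_smul_id⟩
  have h' : HasSVEPAt (T - w • ContinuousLinearMap.id ℂ Y) ((z₀ + w) + -w) := by simpa using h
  simpa [sub_eq_add_neg] using h'.sub_smul_id

theorem HasSVEPAt.of_injective_intertwining {S : Y →L[ℂ] Y} {T : Z →L[ℂ] Z} {z₀ : ℂ}
    (hT : HasSVEPAt T z₀) {ι : Y →L[ℂ] Z} (hι : Function.Injective ι)
    (hST : ∀ x, ι (S x) = T (ι x)) : HasSVEPAt S z₀ := by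
  intro f hf hSf
  have hιf : ι ∘ f =ᶠ[𝓝 z₀] 0 := by
    refine hT _ ((ι.analyticAt _).comp hf) ?_
    filter_upwards [hSf] with z hz
    simp only [Function.comp_apply, ← hST, hz, map_smul]
  filter_upwards [hιf] with z hz
  exact hι (hz.trans (map_zero ι).symm)

theorem hasSVEPAt_of_frequently_injective {T : Y →L[ℂ] Y} {z₀ : ℂ}
    (hT : ∃ᶠ z in 𝓝[≠] z₀, Function.Injective (T - z • ContinuousLinearMap.id ℂ Y : Y →L[ℂ] Y)) :
    HasSVEPAt T z₀ := by
  intro f hf hTf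
  refine hf.frequently_zero_iff_eventually_zero.1 ?_
  refine (hT.and_eventually (hTf.filter_mono nhdsWithin_le_nhds)).mono fun z ⟨hinj, hz⟩ => ?_
  exact (injective_iff_map_eq_zero _).1 hinj _ (by rw [sub_smul_id_apply, hz, sub_self])

theorem hasSVEPAt_of_mem_frontier_spectrum [CompleteSpace Y] {T : Y →L[ℂ] Y} {z₀ : ℂ}
    (hz₀ : z₀ ∈ frontier (spectrum ℂ T)) : HasSVEPAt T z₀ := by
  refine hasSVEPAt_of_frequently_injective (frequently_nhdsWithin_iff.2 ?_)
  have hmem : z₀ ∈ spectrum ℂ T := (spectrum.isClosed T).frontier_subset hz₀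
  rw [frontier_eq_closure_inter_closure, Set.mem_inter_iff, mem_closure_iff_frequently,
    mem_closure_iff_frequently] at hz₀
  refine hz₀.2.mono fun z hz => ⟨((notMem_spectrum_iff_bijective T z).1 hz).1, ?_⟩
  rintro rfl
  exact hz hmem

end LocalSVEP

section AnalyticCore

variable {Y : Type*} [NormedAddCommGroup Y] [NormedSpace ℂ Y]

/-- Mbekhta's analytic core of `T`: the vectors `x` that start a backward orbit
`… ↦ u 2 ↦ u 1 ↦ u 0 = x` of `T` of at most geometric growth. -/
def analyticCore (T : Y →L[ℂ] Y) : Set Y :=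
  {x | ∃ (u : ℕ → Y) (C : ℝ), 0 < C ∧ u 0 = x ∧ (∀ n, T (u (n + 1)) = u n) ∧
    ∀ n, ‖u n‖ ≤ C ^ n * ‖x‖}

theorem eventually_summable_pow_smul [CompleteSpace Y] {u : ℕ → Y} {C D : ℝ} (hC : 0 < C)
    (hu : ∀ n, ‖u n‖ ≤ C ^ n * D) : ∀ᶠ z : ℂ in 𝓝 0, Summable fun n => z ^ n • u n := by
  filter_upwards [Metric.ball_mem_nhds (0 : ℂ) (inv_pos.2 hC)] with z hz
  rw [mem_ball_zero_iff, ← mul_one C⁻¹, lt_inv_mul_iff₀ hC] at hz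
  have hgeom : Summable fun n => (C * ‖z‖) ^ n * D :=
    (summable_geometric_of_lt_one (by positivity) hz).mul_right D
  refine hgeom.of_norm_bounded fun n => ?_
  calc ‖z ^ n • u n‖ ≤ ‖z‖ ^ n * (C ^ n * D) := by
        rw [norm_smul, norm_pow]
        gcongr
        exact hu n
    _ = (C * ‖z‖) ^ n * D := by ring

theorem analyticAt_tsum_pow_smul {u : ℕ → Y} (hu : ∀ᶠ z : ℂ in 𝓝 0, Summable fun n => z ^ n • u n) :
    AnalyticAt ℂ (fun z : ℂ => ∑' n, z ^ n • u n) 0 := by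
  refine ⟨fun n => ContinuousMultilinearMap.mkPiRing ℂ (Fin n) (u n), hasFPowerSeriesAt_iff.2 ?_⟩
  filter_upwards [hu] with z hz
  simpa [FormalMultilinearSeries.coeff] using hz.hasSum

theorem HasSVEPAt.eq_zero_of_mem_analyticCore [CompleteSpace Y] {T : Y →L[ℂ] Y}
    (hT : HasSVEPAt T 0) {x : Y} (hx : x ∈ analyticCore T) (hTx : T x = 0) : x = 0 := by
  obtain ⟨u, C, hC, rfl, hTu, hu⟩ := hx
  have hsum := eventually_summable_pow_smul hC hu
  -- `z ↦ ∑ zⁿ uₙ` is an eigenvector germ because `T u₀ = 0`.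
  have hzero := hT _ (analyticAt_tsum_pow_smul hsum) (by
    filter_upwards [hsum] with z hz
    rw [T.map_tsum hz, (hz.mapL T).tsum_eq_zero_add, ← tsum_const_smul'' z]
    simp [hTx, hTu, pow_succ', mul_smul])
  have hat0 : ∑' n, (0 : ℂ) ^ n • u n = 0 := hzero.eq_of_nhds
  rwa [tsum_eq_single 0 (fun n hn => by simp [hn]), pow_zero, one_smul] at hat0

theorem subset_analyticCore_of_lifting {T : Y →L[ℂ] Y} {K : Set Y} {C : ℝ} (hC : 0 < C)
    (hK : ∀ y ∈ K, ∃ x ∈ K, T x = y ∧ ‖x‖ ≤ C * ‖y‖) : K ⊆ analyticCore T := by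
  intro x hx
  choose! g hgK hTg hg using hK
  have hmem (n : ℕ) : g^[n] x ∈ K := Set.MapsTo.iterate hgK n hx
  refine ⟨fun n => g^[n] x, C, hC, rfl, fun n => ?_, fun n => ?_⟩
  · simp only [Function.iterate_succ_apply', hTg _ (hmem n)]
  · induction n with
    | zero => simp
    | succ n ih =>
      simp only [Function.iterate_succ_apply', pow_succ', mul_assoc]
      exact (hg _ (hmem n)).trans (by gcongr)

theorem HasSVEPAt.injective_of_surjective [CompleteSpace Y] {T : Y →L[ℂ] Y} (hT : HasSVEPAt T 0)
    (hsurj : Function.Surjective T) : Function.Injective T := by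
  obtain ⟨C, hC, hlift⟩ := T.exists_preimage_norm_le hsurj
  have hcore : Set.univ ⊆ analyticCore T :=
    subset_analyticCore_of_lifting hC fun y _ => by simpa using hlift y
  exact (injective_iff_map_eq_zero T).2 fun x => hT.eq_zero_of_mem_analyticCore (hcore trivial)

end AnalyticCore

section Decomposable

open Metric

variable {X : Type*} [NormedAddCommGroup X] [NormedSpace ℂ X]

theorem isPreconnected_setOf_le_dist (c : ℂ) (r : ℝ) : IsPreconnected {z : ℂ | r ≤ dist z c} := by
  have himage : (fun p : ℝ × ℝ => circleMap c p.1 p.2) '' Set.Ici (max r 0) ×ˢ Set.univ =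
      {z : ℂ | r ≤ dist z c} := by
    ext z
    constructor
    · rintro ⟨⟨t, θ⟩, ⟨ht, -⟩, rfl⟩
      rw [Set.mem_Ici, max_le_iff] at ht
      simpa [dist_eq_norm, circleMap, abs_of_nonneg ht.2] using ht.1
    · intro hz
      have hzrange : z ∈ Set.range (circleMap c (dist z c)) := by
        rw [range_circleMap, abs_of_nonneg dist_nonneg]
        exact mem_sphere.2 rfl
      obtain ⟨θ, hθ⟩ := hzrange
      exact ⟨(dist z c, θ), ⟨max_le hz dist_nonneg, trivial⟩, hθ⟩
  rw [← himage]
  exact (isPreconnected_Ici.prod isPreconnected_univ).image _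
    (by unfold circleMap; fun_prop)

theorem disjoint_spectrum_of_isPreconnected_of_surjective [CompleteSpace X] {T : X →L[ℂ] X}
    {K : Set ℂ} (hK : IsPreconnected K)
    (hsurj : ∀ z ∈ K, Function.Surjective (T - z • ContinuousLinearMap.id ℂ X))
    {w : ℂ} (hwK : w ∈ K) (hw : w ∉ spectrum ℂ T) : Disjoint K (spectrum ℂ T) := by
  have hfrontier : Disjoint (frontier (spectrum ℂ T)) K := by
    refine Set.disjoint_left.2 fun z hz hzK => ?_
    have hSVEP : HasSVEPAt (T - z • ContinuousLinearMap.id ℂ X) 0 := by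
      simpa [hasSVEPAt_sub_smul_id_iff] using hasSVEPAt_of_mem_frontier_spectrum hz
    have hbij := And.intro (hSVEP.injective_of_surjective (hsurj z hzK)) (hsurj z hzK)
    exact (notMem_spectrum_iff_bijective T z).2 hbij ((spectrum.isClosed T).frontier_subset hz)
  have : PreconnectedSpace K := Subtype.preconnectedSpace hK
  have hclopen := isClopen_preimage_val (spectrum.isClosed T).isOpen_compl
    (frontier_compl (spectrum ℂ T) ▸ hfrontier)
  have huniv := hclopen.eq_univ ⟨⟨w, hwK⟩, hw⟩
  refine Set.disjoint_left.2 fun z hz => ?_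
  exact (huniv ▸ Set.mem_univ _ : (⟨z, hz⟩ : K) ∈ Subtype.val ⁻¹' (spectrum ℂ T)ᶜ)

theorem notMem_spectrum_of_forall_surjective [CompleteSpace X] {T : X →L[ℂ] X} {c : ℂ} {r : ℝ}
    (hsurj : ∀ z, r ≤ dist z c → Function.Surjective (T - z • ContinuousLinearMap.id ℂ X))
    {z : ℂ} (hz : r ≤ dist z c) : z ∉ spectrum ℂ T := by
  have hunbounded : ∃ w, r ≤ dist w c ∧ w ∉ spectrum ℂ T := by
    have hfar := (tendsto_dist_right_cobounded_atTop c).eventually_ge_atTop r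
    have hbounded := Bornology.isBounded_def.1 (spectrum.isBounded (𝕜 := ℂ) T)
    exact (hfar.and hbounded).exists
  obtain ⟨w, hwr, hw⟩ := hunbounded
  exact Set.disjoint_left.1 (disjoint_spectrum_of_isPreconnected_of_surjective
    (isPreconnected_setOf_le_dist c r) hsurj hwr hw) hz

theorem bijOn_of_notMem_spectrum_restrict [CompleteSpace X] {T : X →L[ℂ] X}
    {M : Submodule ℂ X} {hM : ∀ x ∈ M, T x ∈ M} (hMc : IsClosed (M : Set X)) {z : ℂ}
    (hz : z ∉ spectrum ℂ (T.restrict hM)) : Set.BijOn (fun x => T x - z • x) M M := by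
  have : CompleteSpace M := hMc.completeSpace_coe
  have hbij := (notMem_spectrum_iff_bijective _ z).1 hz
  refine ⟨fun x hx => M.sub_mem (hM x hx) (M.smul_mem z hx), fun x hx y hy hxy => ?_,
    fun y hy => ?_⟩
  · exact congrArg Subtype.val (@hbij.1 ⟨x, hx⟩ ⟨y, hy⟩ (Subtype.ext (by simpa using hxy)))
  · obtain ⟨x, hx⟩ := hbij.2 ⟨y, hy⟩
    exact ⟨x, x.2, by simpa using congrArg Subtype.val hx⟩

theorem eq_zero_of_eq_zero_near_sphere {E : Type*} [NormedAddCommGroup E] [NormedSpace ℂ E]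
    {f : ℂ → E} {c : ℂ} {r R : ℝ} (hrR : r < R) (hf : AnalyticOnNhd ℂ f (ball c R))
    (hzero : ∀ z ∈ ball c R, r ≤ dist z c → f z = 0) : Set.EqOn f 0 (ball c R) := by
  rcases le_or_gt R 0 with hR | hR
  · simp [ball_eq_empty.2 hR]
  obtain ⟨s, hs, hsR⟩ := exists_between (max_lt hrR hR)
  rw [max_lt_iff] at hs
  set w : ℂ := c + s with hw
  have hwc : dist w c = s := by
    rw [hw, dist_self_add_left, Complex.norm_real, Real.norm_of_nonneg hs.2.le]
  have hwR : w ∈ ball c R := by rwa [mem_ball, hwc]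
  refine hf.eqOn_zero_of_preconnected_of_eventuallyEq_zero (convex_ball c R).isPreconnected hwR ?_
  have hfar : IsOpen {z : ℂ | r < dist z c} := isOpen_lt continuous_const (by fun_prop)
  filter_upwards [isOpen_ball.mem_nhds hwR, hfar.mem_nhds (hs.1.trans_eq hwc.symm)] with z hzR hzr
    using hzero z hzR (le_of_lt hzr)

theorem IsDecomposable.exists_invariant_subspaces {T : X →L[ℂ] X} (hT : IsDecomposable T)
    (c : ℂ) {r : ℝ} (hr : 0 < r) :
    ∃ (X₁ X₂ : Submodule ℂ X) (h₁ : ∀ x ∈ X₁, T x ∈ X₁) (h₂ : ∀ x ∈ X₂, T x ∈ X₂),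
      IsClosed (X₁ : Set X) ∧ IsClosed (X₂ : Set X) ∧ X₁ ⊔ X₂ = ⊤ ∧
        c ∉ spectrum ℂ (T.restrict h₁) ∧
        ∀ z, r ≤ dist z c → z ∉ spectrum ℂ (T.restrict h₂) := by
  have hcover : {c}ᶜ ∪ ball c r = Set.univ := Set.compl_subset_iff_union.1 (by simpa using hr)
  obtain ⟨X₁, X₂, h₁, h₂, hc₁, hc₂, hsup, hs₁, hs₂⟩ :=
    hT {c}ᶜ (ball c r) isOpen_compl_singleton isOpen_ball hcover
  exact ⟨X₁, X₂, h₁, h₂, hc₁, hc₂, hsup, fun hc => hs₁ hc rfl,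
    fun z hz hmem => hz.not_gt (hs₂ hmem)⟩

theorem IsDecomposable.hasSVEP_adj [CompleteSpace X] {T : X →L[ℂ] X} (hT : IsDecomposable T) :
    HasSVEP (adj T) := by
  rintro - U hU - f hf hTf c hc
  obtain ⟨R, hR, hRU⟩ := isOpen_iff.1 hU c hc
  obtain ⟨X₁, X₂, h₁, h₂, hc₁, hc₂, hsup, hs₁, hs₂⟩ :=
    hT.exists_invariant_subspaces c (half_pos hR)
  have hannihilates (z : ℂ) (hz : z ∈ U) (y : X) : f z (T y - z • y) = 0 := by
    simpa [adj_apply] using DFunLike.congr_fun (hTf z hz) y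
  refine LinearMap.ext_on_codisjoint (codisjoint_iff.2 hsup) (fun x₁ hx₁ => ?_) fun x₂ hx₂ => ?_
  · obtain ⟨y, -, rfl⟩ := (bijOn_of_notMem_spectrum_restrict hc₁ hs₁).surjOn hx₁
    exact hannihilates c hc y
  · suffices Set.EqOn (fun z => f z x₂) 0 (ball c R) from this (mem_ball_self hR)
    refine eq_zero_of_eq_zero_near_sphere (half_lt_self hR)
      ((ContinuousLinearMap.apply ℂ ℂ x₂).comp_analyticOnNhd (hf.mono hRU)) fun z hzR hzr => ?_
    obtain ⟨y, -, rfl⟩ := (bijOn_of_notMem_spectrum_restrict hc₂ (hs₂ z hzr)).surjOn hx₂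
    exact hannihilates z (hRU hzR) y

/-- The operator induced by `T` on the quotient by a `T`-invariant subspace. -/
def quotientMap (T : X →L[ℂ] X) (M : Submodule ℂ X) (hM : ∀ x ∈ M, T x ∈ M) :
    X ⧸ M →L[ℂ] X ⧸ M :=
  M.liftQL (M.mkQL.comp T) (fun x hx => by simpa using hM x hx)

theorem quotientMap_sub_smul_mkQL (T : X →L[ℂ] X) (M : Submodule ℂ X) (hM : ∀ x ∈ M, T x ∈ M)
    (z : ℂ) (x : X) :
    quotientMap T M hM (M.mkQL x) - z • M.mkQL x = M.mkQL (T x - z • x) := rfl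

theorem surjective_quotientMap_sub_smul_id [CompleteSpace X] {T : X →L[ℂ] X}
    {M N : Submodule ℂ X} {hM : ∀ x ∈ M, T x ∈ M} {hN : ∀ x ∈ N, T x ∈ N}
    (hNc : IsClosed (N : Set X)) (hMN : Codisjoint M N) {z : ℂ}
    (hz : z ∉ spectrum ℂ (T.restrict hN)) :
    Function.Surjective (quotientMap T M hM - z • ContinuousLinearMap.id ℂ (X ⧸ M)) := by
  intro q
  obtain ⟨x, rfl⟩ := M.mkQ_surjective q
  obtain ⟨m, n, hm, hn, rfl⟩ := Submodule.codisjoint_iff_exists_add_eq.1 hMN x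
  obtain ⟨y, -, rfl⟩ := (bijOn_of_notMem_spectrum_restrict hNc hz).surjOn hn
  refine ⟨M.mkQL y, ?_⟩
  rw [sub_smul_id_apply, quotientMap_sub_smul_mkQL]
  simpa using hm

theorem IsDecomposable.hasSVEP [CompleteSpace X] {T : X →L[ℂ] X} (hT : IsDecomposable T) :
    HasSVEP T := by
  rintro - U hU - f hf hTf c hc
  obtain ⟨R, hR, hRU⟩ := isOpen_iff.1 hU c hc
  obtain ⟨X₁, X₂, h₁, h₂, hc₁, hc₂, hsup, hs₁, hs₂⟩ :=
    hT.exists_invariant_subspaces c (half_pos hR)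
  simp only [sub_smul_id_apply] at hTf
  have : IsClosed (X₁ : Set X) := hc₁
  have hquotient : Set.EqOn (fun z => X₁.mkQL (f z)) 0 (ball c R) := by
    refine eq_zero_of_eq_zero_near_sphere (half_lt_self hR)
      (X₁.mkQL.comp_analyticOnNhd (hf.mono hRU)) fun z hzR hzr => ?_
    have hz : z ∉ spectrum ℂ (quotientMap T X₁ h₁) := notMem_spectrum_of_forall_surjective
      (fun w hw => surjective_quotientMap_sub_smul_id hc₂ (codisjoint_iff.2 hsup) (hs₂ w hw)) hzr
    refine (injective_iff_map_eq_zero _).1 ((notMem_spectrum_iff_bijective _ z).1 hz).1 _ ?_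
    rw [sub_smul_id_apply, quotientMap_sub_smul_mkQL, hTf z (hRU hzR), map_zero]
  have hfc : f c ∈ X₁ := by simpa using hquotient (mem_ball_self hR)
  refine (bijOn_of_notMem_spectrum_restrict hc₁ hs₁).injOn hfc X₁.zero_mem ?_
  simpa using hTf c hc

end Decomposable

section PseudoFredholm

variable {X : Type*} [NormedAddCommGroup X] [NormedSpace ℂ X]

theorem exists_preimage_norm_le_of_isClosed_range [CompleteSpace X] {A : X →L[ℂ] X}
    (hA : IsClosed (Set.range A)) :
    ∃ C > 0, ∀ y ∈ Set.range A, ∃ x, A x = y ∧ ‖x‖ ≤ C * ‖y‖ := by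
  have : CompleteSpace A.range := IsClosed.completeSpace_coe (hs := hA)
  obtain ⟨C, hC, hlift⟩ := A.rangeRestrict.exists_preimage_norm_le
    A.toLinearMap.surjective_rangeRestrict
  refine ⟨C, hC, fun y hy => ?_⟩
  obtain ⟨x, hx, hxy⟩ := hlift ⟨y, hy⟩
  exact ⟨x, congrArg Subtype.val hx, hxy⟩

theorem IsSemiRegular.mem_iInter_range_pow_of_apply_mem {A : X →L[ℂ] X} (hA : IsSemiRegular A)
    {x : X} (hx : A x ∈ ⋂ n : ℕ, Set.range (A ^ n)) : x ∈ ⋂ n : ℕ, Set.range (A ^ n) := by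
  rw [Set.mem_iInter] at hx ⊢
  intro n
  obtain ⟨u, hu⟩ := hx (n + 1)
  have hker : A (x - (A ^ n) u) = 0 := by
    rw [map_sub, sub_eq_zero, ← hu, pow_succ', mul_apply_eq_comp]
  obtain ⟨v, hv⟩ := hA.2 _ hker n
  exact ⟨v + u, by rw [map_add, hv, sub_add_cancel]⟩

theorem IsSemiRegular.iInter_range_pow_subset_analyticCore [CompleteSpace X] {A : X →L[ℂ] X}
    (hA : IsSemiRegular A) : ⋂ n : ℕ, Set.range (A ^ n) ⊆ analyticCore A := by
  obtain ⟨C, hC, hlift⟩ := exists_preimage_norm_le_of_isClosed_range hA.1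
  refine subset_analyticCore_of_lifting hC fun y hy => ?_
  obtain ⟨x, rfl, hx⟩ := hlift y (by simpa using Set.mem_iInter.1 hy 1)
  exact ⟨x, hA.mem_iInter_range_pow_of_apply_mem hy, rfl, hx⟩

theorem IsSemiRegular.injective [CompleteSpace X] {A : X →L[ℂ] X} (hA : IsSemiRegular A)
    (hSVEP : HasSVEPAt A 0) : Function.Injective A :=
  (injective_iff_map_eq_zero A).2 fun x hx => hSVEP.eq_zero_of_mem_analyticCore
    (hA.iInter_range_pow_subset_analyticCore (Set.mem_iInter.2 (hA.2 x hx))) hx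

theorem surjective_adj_of_injective [CompleteSpace X] {A : X →L[ℂ] X}
    (hA : IsClosed (Set.range A)) (hinj : Function.Injective A) : Function.Surjective (adj A) := by
  intro φ
  let e := A.equivRange hinj hA
  obtain ⟨ψ, hψ, -⟩ := exists_extension_norm_eq A.range (φ.comp (e.symm : A.range →L[ℂ] X))
  refine ⟨ψ, ?_⟩
  ext x
  exact (hψ (e x)).trans (congrArg φ (e.symm_apply_apply x))

theorem injective_adj_of_surjective {A : X →L[ℂ] X} (hA : Function.Surjective A) :
    Function.Injective (adj A) := by
  intro φ ψ h
  ext x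
  obtain ⟨y, rfl⟩ := hA x
  exact DFunLike.congr_fun h y

theorem surjective_of_injective_adj {A : X →L[ℂ] X} (hA : IsClosed (Set.range A))
    (hinj : Function.Injective (adj A)) : Function.Surjective A := by
  have : IsClosed (A.range : Set X) := hA
  have hquotient (x : X) : A.range.mkQL x = 0 := by
    refine SeparatingDual.eq_zero_of_forall_dual_eq_zero (R := ℂ) fun g => ?_
    have hg : g.comp A.range.mkQL = 0 := by
      refine (injective_iff_map_eq_zero (adj A)).1 hinj _ ?_
      ext y
      have hy : A.range.mkQL (A y) = 0 := by simp
      exact (congrArg g hy).trans (map_zero g)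
    exact DFunLike.congr_fun hg x
  intro x
  simpa using hquotient x

theorem IsSemiRegular.bijective [CompleteSpace X] {A : X →L[ℂ] X} (hA : IsSemiRegular A)
    (hSVEP : HasSVEPAt A 0) (hSVEP' : HasSVEPAt (adj A) 0) : Function.Bijective A := by
  have hinj := hA.injective hSVEP
  have hsurj := surjective_adj_of_injective hA.1 hinj
  exact ⟨hinj, surjective_of_injective_adj hA.1 (hSVEP'.injective_of_surjective hsurj)⟩

theorem isSemiRegular_of_bijective {A : X →L[ℂ] X} (hA : Function.Bijective A) :
    IsSemiRegular A := by
  refine ⟨by rw [hA.2.range_eq]; exact isClosed_univ, fun x hx n => ?_⟩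
  rw [(injective_iff_map_eq_zero A).1 hA.1 x hx]
  exact ⟨0, map_zero _⟩

theorem HasSVEPAt.restrict {T : X →L[ℂ] X} {M : Submodule ℂ X} {z : ℂ} (hT : HasSVEPAt T z)
    (hM : ∀ x ∈ M, T x ∈ M) : HasSVEPAt (T.restrict hM) z :=
  hT.of_injective_intertwining (ι := M.subtypeL) Subtype.val_injective fun _ => rfl

theorem projectionOntoL_apply_comm {T : X →L[ℂ] X} {M N : Submodule ℂ X}
    (hMN : M.IsTopCompl N) (hM : ∀ x ∈ M, T x ∈ M) (hN : ∀ x ∈ N, T x ∈ N) (x : X) :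
    M.projectionOntoL N hMN (T x) = T.restrict hM (M.projectionOntoL N hMN x) := by
  obtain ⟨m, n, hm, hn, rfl⟩ := Submodule.codisjoint_iff_exists_add_eq.1 hMN.isCompl.codisjoint x
  have hzero {y : X} (hy : y ∈ N) : M.projectionOntoL N hMN y = 0 :=
    (M.projectionOntoL_apply_eq_zero_iff hMN).2 hy
  have hself {y : X} (hy : y ∈ M) : M.projectionOntoL N hMN y = ⟨y, hy⟩ :=
    M.projectionOntoL_apply_left hMN ⟨y, hy⟩
  rw [map_add, map_add, map_add, hzero hn, hzero (hN n hn), hself hm, hself (hM m hm), add_zero,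
    add_zero]
  rfl

theorem HasSVEPAt.adj_restrict {T : X →L[ℂ] X} {M N : Submodule ℂ X} {z : ℂ}
    (hT : HasSVEPAt (adj T) z) (hMN : M.IsTopCompl N) (hM : ∀ x ∈ M, T x ∈ M)
    (hN : ∀ x ∈ N, T x ∈ N) : HasSVEPAt (adj (T.restrict hM)) z := by
  refine hT.of_injective_intertwining
    (ι := ContinuousLinearMap.precomp ℂ (M.projectionOntoL N hMN)) ?_ fun φ => ?_
  · intro φ ψ h
    ext m
    simpa using DFunLike.congr_fun h (m : X)
  · ext x
    exact congrArg φ (projectionOntoL_apply_comm hMN hM hN x).symm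

theorem bijective_of_isCompl_of_bijective_restrict {R E : Type*} [Ring R] [AddCommGroup E]
    [Module R E] {f : E →ₗ[R] E} {p q : Submodule R E} (hpq : IsCompl p q)
    (hp : ∀ x ∈ p, f x ∈ p) (hq : ∀ x ∈ q, f x ∈ q)
    (hfp : Function.Bijective (f.restrict hp)) (hfq : Function.Bijective (f.restrict hq)) :
    Function.Bijective f := by
  let e := Submodule.prodEquivOfIsCompl p q hpq
  have hconj : f ∘ e = e ∘ Prod.map (f.restrict hp) (f.restrict hq) := by
    ext ⟨x, y⟩
    simp [e]
  rw [← e.bijective.of_comp_iff, hconj]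
  exact e.bijective.comp (hfp.prodMap hfq)

theorem spectrum_subset_union_of_isCompl [CompleteSpace X] {T : X →L[ℂ] X} {M N : Submodule ℂ X}
    (hMN : IsCompl M N) (hMc : IsClosed (M : Set X)) (hNc : IsClosed (N : Set X))
    (hM : ∀ x ∈ M, T x ∈ M) (hN : ∀ x ∈ N, T x ∈ N) :
    spectrum ℂ T ⊆ spectrum ℂ (T.restrict hM) ∪ spectrum ℂ (T.restrict hN) := by
  have := hMc.completeSpace_coe
  have := hNc.completeSpace_coe
  intro z hz
  contrapose! hz
  rw [Set.mem_union, not_or, notMem_spectrum_iff_bijective, notMem_spectrum_iff_bijective] at hz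
  rw [notMem_spectrum_iff_bijective]
  exact bijective_of_isCompl_of_bijective_restrict
    (f := (T - z • ContinuousLinearMap.id ℂ X : X →L[ℂ] X).toLinearMap) hMN
    (fun x hx => by simpa using M.sub_mem (hM x hx) (M.smul_mem z hx))
    (fun x hx => by simpa using N.sub_mem (hN x hx) (N.smul_mem z hx)) hz.1 hz.2

theorem eventually_notMem_spectrum_of_bijective [CompleteSpace X] {T : X →L[ℂ] X}
    (hT : Function.Bijective T) : ∀ᶠ z in 𝓝 (0 : ℂ), z ∉ spectrum ℂ T := by
  refine (spectrum.isClosed T).isOpen_compl.eventually_mem ?_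
  rwa [Set.mem_compl_iff, notMem_spectrum_iff_bijective, zero_smul, sub_zero]

theorem isQuasinilpotent_iff (T : X →L[ℂ] X) :
    IsQuasinilpotent T ↔ ∀ z ∈ spectrum ℂ T, z = 0 := by
  simp [IsQuasinilpotent, spectralRadius]

theorem isGenDrazinInvertible_iff_eventually (T : X →L[ℂ] X) :
    IsGenDrazinInvertible T ↔ ∀ᶠ z in 𝓝[≠] (0 : ℂ), z ∉ spectrum ℂ T := by
  rw [IsGenDrazinInvertible, accPt_iff_frequently_nhdsNE, not_frequently]

theorem IsPseudoFredholm.isGenDrazinInvertible [CompleteSpace X] {T : X →L[ℂ] X}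
    (hT : IsPseudoFredholm T) (hSVEP : HasSVEPAt T 0) (hSVEP' : HasSVEPAt (adj T) 0) :
    IsGenDrazinInvertible T := by
  obtain ⟨M, N, hM, hN, hMc, hNc, hMN, hregular, hquasi⟩ := hT
  have := hMc.completeSpace_coe
  have := hNc.completeSpace_coe
  have htop := Submodule.IsCompl.isTopCompl_of_isClosed hMN hMc hNc
  have hbij : Function.Bijective (T.restrict hM) :=
    hregular.bijective (hSVEP.restrict hM) (hSVEP'.adj_restrict htop hM hN)
  have hM0 := eventually_notMem_spectrum_of_bijective hbij
  rw [isGenDrazinInvertible_iff_eventually]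
  filter_upwards [hM0.filter_mono nhdsWithin_le_nhds, self_mem_nhdsWithin] with z hzM hz0 hz
  exact (spectrum_subset_union_of_isCompl hMN hMc hNc hM hN hz).elim hzM
    fun hzN => hz0 ((isQuasinilpotent_iff (T.restrict hN)).1 hquasi z hzN)

end PseudoFredholm

section RieszProjection

open Metric
open scoped Real

variable {E F : Type*} [NormedAddCommGroup E] [NormedSpace ℂ E] [CompleteSpace E]
  [NormedAddCommGroup F] [NormedSpace ℂ F] [CompleteSpace F]

theorem map_circleIntegral (L : E →L[ℂ] F) {f : ℂ → E} {c : ℂ} {R : ℝ}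
    (hf : CircleIntegrable f c R) : L (∮ z in C(c, R), f z) = ∮ z in C(c, R), L (f z) := by
  simp only [circleIntegral, ← map_smul]
  exact (L.intervalIntegral_comp_comm hf.out).symm

theorem circleIntegral_sub_inv_of_notMem_closedBall {c w : ℂ} {R : ℝ} (hR : 0 ≤ R)
    (hw : w ∉ closedBall c R) : (∮ z in C(c, R), (z - w)⁻¹) = 0 := by
  refine DiffContOnCl.circleIntegral_eq_zero hR (DifferentiableOn.diffContOnCl ?_)
  refine DifferentiableOn.inv (by fun_prop) fun z hz => sub_ne_zero.2 ?_
  rintro rfl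
  exact hw (closure_ball_subset_closedBall hz)

theorem differentiableOn_cauchyIntegral {f : ℂ → E} {c : ℂ} {R : ℝ}
    (hf : CircleIntegrable f c R) :
    DifferentiableOn ℂ (fun w => (2 * π * Complex.I)⁻¹ • ∮ z in C(c, R), (z - w)⁻¹ • f z)
      (ball c R) := by
  rcases le_or_gt R 0 with hR | hR
  · rw [ball_eq_empty.2 hR]
    exact differentiableOn_empty
  lift R to NNReal using hR.le
  simpa only [eball_coe] using
    (hasFPowerSeriesOn_cauchy_integral hf (by exact_mod_cast hR)).differentiableOn

variable {A : Type*} [NormedRing A] [NormedAlgebra ℂ A]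

/-- The Riesz projection `(2πi)⁻¹ ∮ (z - a)⁻¹ dz` of `a` over the circle `|z - c| = R`. It is a
projection when the circle avoids the spectrum of `a`. -/
noncomputable def rieszProjection (a : A) (c : ℂ) (R : ℝ) : A :=
  (2 * π * Complex.I)⁻¹ • ∮ z in C(c, R), resolvent a z

/-- The Cauchy transform `w ↦ (2πi)⁻¹ ∮ (z - w)⁻¹ (z - a)⁻¹ dz` of the resolvent of `a` over the
circle `|z - c| = R`. It inverts `w - a` on the kernel of the Riesz projection for `w` inside the
circle, and `a - w` on its range for `w` outside. -/
noncomputable def cauchyResolvent (a : A) (c : ℂ) (R : ℝ) (w : ℂ) : A :=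
  (2 * π * Complex.I)⁻¹ • ∮ z in C(c, R), (z - w)⁻¹ • resolvent a z

theorem algebraMap_sub_mul_resolvent {a : A} {z : ℂ} (hz : z ∈ resolventSet ℂ a) (w : ℂ) :
    (algebraMap ℂ A w - a) * resolvent a z = 1 - (z - w) • resolvent a z := by
  have hinv : (algebraMap ℂ A z - a) * resolvent a z = 1 := Ring.mul_inverse_cancel _ hz
  rw [← hinv, Algebra.smul_def, ← sub_mul, map_sub]
  congr 1
  abel

theorem commute_resolvent (a : A) (z : ℂ) : Commute a (resolvent a z) := by
  by_cases hz : IsUnit (algebraMap ℂ A z - a)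
  · obtain ⟨u, hu⟩ := hz
    have hcomm : Commute a u :=
      hu ▸ (Algebra.commute_algebraMap_right z a).sub_right (Commute.refl a)
    rw [resolvent, ← hu, Ring.inverse_unit]
    exact hcomm.units_inv_right
  · rw [resolvent, Ring.inverse_non_unit _ hz]
    exact Commute.zero_right a

variable [CompleteSpace A]

theorem differentiableOn_resolvent (a : A) :
    DifferentiableOn ℂ (resolvent a) (resolventSet ℂ a) := fun _ hz =>
  (spectrum.hasDerivAt_resolvent_const_left hz).differentiableAt.differentiableWithinAt

theorem commute_circleIntegral {a : A} {f : ℂ → A} {c : ℂ} {R : ℝ} (hf : CircleIntegrable f c R)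
    (hcomm : ∀ z, Commute a (f z)) : Commute a (∮ z in C(c, R), f z) := by
  have hleft := map_circleIntegral (ContinuousLinearMap.mul ℂ A a) hf
  have hright := map_circleIntegral ((ContinuousLinearMap.mul ℂ A).flip a) hf
  simp only [ContinuousLinearMap.mul_apply', ContinuousLinearMap.flip_apply] at hleft hright
  rw [commute_iff_eq, hleft, hright]
  simp only [(hcomm _).eq]

section Circle

variable {a : A} {c : ℂ} {R : ℝ}

theorem circleIntegrable_resolvent (hR : 0 ≤ R) (ha : sphere c R ⊆ resolventSet ℂ a) :
    CircleIntegrable (resolvent a) c R :=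
  ((differentiableOn_resolvent a).continuousOn.mono ha).circleIntegrable hR

theorem circleIntegrable_sub_inv_smul_resolvent (hR : 0 ≤ R) (ha : sphere c R ⊆ resolventSet ℂ a)
    {w : ℂ} (hw : w ∉ sphere c R) :
    CircleIntegrable (fun z => (z - w)⁻¹ • resolvent a z) c R := by
  refine ContinuousOn.circleIntegrable hR (ContinuousOn.smul ?_
    ((differentiableOn_resolvent a).continuousOn.mono ha))
  refine ContinuousOn.inv₀ (by fun_prop) fun z hz => sub_ne_zero.2 ?_
  rintro rfl
  exact hw hz

theorem commute_rieszProjection (hR : 0 ≤ R) (ha : sphere c R ⊆ resolventSet ℂ a) :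
    Commute a (rieszProjection a c R) :=
  (commute_circleIntegral (circleIntegrable_resolvent hR ha) (commute_resolvent a)).smul_right _

theorem commute_cauchyResolvent (hR : 0 ≤ R) (ha : sphere c R ⊆ resolventSet ℂ a) {w : ℂ}
    (hw : w ∉ sphere c R) : Commute a (cauchyResolvent a c R w) :=
  (commute_circleIntegral (circleIntegrable_sub_inv_smul_resolvent hR ha hw)
    fun z => (commute_resolvent a z).smul_right _).smul_right _

theorem algebraMap_sub_mul_cauchyResolvent (hR : 0 ≤ R) (ha : sphere c R ⊆ resolventSet ℂ a)
    {w : ℂ} (hw : w ∉ sphere c R) :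
    (algebraMap ℂ A w - a) * cauchyResolvent a c R w =
      ((2 * π * Complex.I)⁻¹ * ∮ z in C(c, R), (z - w)⁻¹) • (1 : A) - rieszProjection a c R := by
  have hne {z : ℂ} (hz : z ∈ sphere c R) : z - w ≠ 0 := by
    rw [sub_ne_zero]
    rintro rfl
    exact hw hz
  have hker : CircleIntegrable (fun z => (z - w)⁻¹ • (1 : A)) c R :=
    ((ContinuousOn.inv₀ (by fun_prop) fun _ => hne).smul continuousOn_const).circleIntegrable hR
  have hcongr : (∮ z in C(c, R), (algebraMap ℂ A w - a) * ((z - w)⁻¹ • resolvent a z)) =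
      ∮ z in C(c, R), (z - w)⁻¹ • (1 : A) - resolvent a z := by
    refine circleIntegral.integral_congr hR fun z hz => ?_
    rw [mul_smul_comm, algebraMap_sub_mul_resolvent (ha hz), smul_sub, inv_smul_smul₀ (hne hz)]
  have hmul := map_circleIntegral (ContinuousLinearMap.mul ℂ A (algebraMap ℂ A w - a))
    (circleIntegrable_sub_inv_smul_resolvent hR ha hw)
  simp only [ContinuousLinearMap.mul_apply'] at hmul
  rw [cauchyResolvent, rieszProjection, mul_smul_comm, hmul, hcongr,
    circleIntegral.integral_sub hker (circleIntegrable_resolvent hR ha),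
    circleIntegral.integral_smul_const, smul_sub, smul_smul]

theorem algebraMap_sub_mul_cauchyResolvent_of_mem_ball (ha : sphere c R ⊆ resolventSet ℂ a)
    {w : ℂ} (hw : w ∈ ball c R) :
    (algebraMap ℂ A w - a) * cauchyResolvent a c R w = 1 - rieszProjection a c R := by
  have hR : 0 < R := pos_of_mem_ball hw
  rw [algebraMap_sub_mul_cauchyResolvent hR.le ha (mem_ball.1 hw).ne,
    circleIntegral.integral_sub_inv_of_mem_ball hw, inv_mul_cancel₀ Complex.two_pi_I_ne_zero,
    one_smul]

theorem algebraMap_sub_mul_cauchyResolvent_of_notMem_closedBall (hR : 0 ≤ R)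
    (ha : sphere c R ⊆ resolventSet ℂ a) {w : ℂ} (hw : w ∉ closedBall c R) :
    (algebraMap ℂ A w - a) * cauchyResolvent a c R w = -rieszProjection a c R := by
  rw [algebraMap_sub_mul_cauchyResolvent hR ha fun h => hw (sphere_subset_closedBall h),
    circleIntegral_sub_inv_of_notMem_closedBall hR hw, mul_zero, zero_smul, zero_sub]

theorem rieszProjection_eq_of_subset_resolventSet {S : ℝ} (hS : 0 < S) (hSR : S ≤ R)
    (ha : closedBall c R \ ball c S ⊆ resolventSet ℂ a) :
    rieszProjection a c R = rieszProjection a c S := by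
  have hdiff := differentiableOn_resolvent a
  rw [rieszProjection, rieszProjection,
    Complex.circleIntegral_eq_of_differentiable_on_annulus_off_countable hS hSR Set.countable_empty
      (hdiff.continuousOn.mono ha)]
  rintro z ⟨⟨hzR, hzS⟩, -⟩
  exact hdiff.differentiableAt ((spectrum.isOpen_resolventSet a).mem_nhds
    (ha ⟨ball_subset_closedBall hzR, fun h => hzS (ball_subset_closedBall h)⟩))

theorem resolvent_mul_rieszProjection (ha : sphere c R ⊆ resolventSet ℂ a) {w : ℂ}
    (hw : w ∈ ball c R) (hwa : w ∈ resolventSet ℂ a) :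
    resolvent a w * rieszProjection a c R = resolvent a w - cauchyResolvent a c R w := by
  have hinv : resolvent a w * (algebraMap ℂ A w - a) = 1 := Ring.inverse_mul_cancel _ hwa
  have hp := algebraMap_sub_mul_cauchyResolvent_of_mem_ball ha hw
  rw [← sub_sub_cancel 1 (rieszProjection a c R), ← hp, mul_sub, mul_one, ← mul_assoc, hinv,
    one_mul]

theorem isIdempotentElem_rieszProjection {S : ℝ} (hS : 0 < S) (hSR : S < R)
    (ha : closedBall c R \ ball c S ⊆ resolventSet ℂ a) :
    IsIdempotentElem (rieszProjection a c R) := by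
  have hRa : sphere c R ⊆ resolventSet ℂ a := fun z hz =>
    ha ⟨sphere_subset_closedBall hz, by simp [mem_sphere.1 hz, hSR.le]⟩
  have hSa : sphere c S ⊆ resolventSet ℂ a := fun z hz =>
    ha ⟨(mem_sphere.1 hz).trans_le hSR.le, by simp [mem_sphere.1 hz]⟩
  have hres := circleIntegrable_resolvent hS.le hSa
  have hcauchy : DifferentiableOn ℂ (cauchyResolvent a c R) (closedBall c S) :=
    (differentiableOn_cauchyIntegral
      (circleIntegrable_resolvent (hS.trans hSR).le hRa)).mono (closedBall_subset_ball hSR)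
  have hcauchy_zero : (∮ z in C(c, S), cauchyResolvent a c R z) = 0 :=
    DiffContOnCl.circleIntegral_eq_zero hS.le
      (hcauchy.mono closure_ball_subset_closedBall).diffContOnCl
  have hcauchy_int : CircleIntegrable (cauchyResolvent a c R) c S :=
    (hcauchy.continuousOn.mono sphere_subset_closedBall).circleIntegrable hS.le
  have hmul := map_circleIntegral ((ContinuousLinearMap.mul ℂ A).flip (rieszProjection a c R)) hres
  simp only [ContinuousLinearMap.flip_apply, ContinuousLinearMap.mul_apply'] at hmul
  have hcongr : (∮ z in C(c, S), resolvent a z * rieszProjection a c R) =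
      ∮ z in C(c, S), resolvent a z - cauchyResolvent a c R z :=
    circleIntegral.integral_congr hS.le fun z hz => resolvent_mul_rieszProjection hRa
      ((mem_sphere.1 hz).trans_lt hSR) (hSa hz)
  -- The Cauchy transform is holomorphic on the smaller disc, so only the resolvent survives.
  have hSRp : rieszProjection a c S * rieszProjection a c R = rieszProjection a c S := by
    conv_lhs => enter [1]; rw [rieszProjection]
    rw [smul_mul_assoc, hmul, hcongr, circleIntegral.integral_sub hres hcauchy_int, hcauchy_zero,
      sub_zero, ← rieszProjection]
  rwa [← rieszProjection_eq_of_subset_resolventSet hS hSR.le ha] at hSRp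

end Circle

end RieszProjection

section GenDrazin

open Metric

variable {X : Type*} [NormedAddCommGroup X] [NormedSpace ℂ X]

theorem bijective_restrict_of_isProj {R E : Type*} [Ring R] [AddCommGroup E] [Module R E]
    {f g e : Module.End R E} {p : Submodule R E} (he : LinearMap.IsProj p e) (hfg : f * g = e)
    (hgf : g * f = e) (hf : ∀ x ∈ p, f x ∈ p) : Function.Bijective (f.restrict hf) := by
  have hright (x : E) : f (g x) = e x := LinearMap.congr_fun hfg x
  have hleft (x : E) : g (f x) = e x := LinearMap.congr_fun hgf x
  refine ⟨(injective_iff_map_eq_zero _).2 fun ⟨x, hx⟩ hfx => Subtype.ext ?_, fun ⟨y, hy⟩ => ?_⟩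
  · have hfx' : f x = 0 := congrArg Subtype.val hfx
    calc x = g (f x) := by rw [hleft, he.map_id x hx]
      _ = 0 := by rw [hfx', map_zero]
  · have hgy : g y ∈ p := by
      rw [← he.map_id y hy, ← hright, hleft]
      exact he.map_mem _
    exact ⟨⟨g y, hgy⟩, Subtype.ext ((hright y).trans (he.map_id y hy))⟩

theorem notMem_spectrum_restrict_of_isProj [CompleteSpace X] {T g e : X →L[ℂ] X}
    {M : Submodule ℂ X} {hM : ∀ x ∈ M, T x ∈ M} (hMc : IsClosed (M : Set X))
    (he : LinearMap.IsProj M e) {z : ℂ} (hTg : Commute T g)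
    (hg : (algebraMap ℂ (X →L[ℂ] X) z - T) * g = e) : z ∉ spectrum ℂ (T.restrict hM) := by
  have := hMc.completeSpace_coe
  have hg' : g * (algebraMap ℂ (X →L[ℂ] X) z - T) = e := by
    rw [← hg, ((Algebra.commute_algebraMap_left z g).sub_left hTg).eq]
  rw [spectrum.notMem_iff, ContinuousLinearMap.isUnit_iff_bijective]
  exact bijective_restrict_of_isProj
    (f := ((algebraMap ℂ (X →L[ℂ] X) z - T : X →L[ℂ] X) : X →ₗ[ℂ] X)) (g := (g : X →ₗ[ℂ] X))
    (e := (e : X →ₗ[ℂ] X)) ⟨he.map_mem, he.map_id⟩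
    (congrArg ContinuousLinearMap.toLinearMap hg) (congrArg ContinuousLinearMap.toLinearMap hg')
    (fun x hx => M.sub_mem (M.smul_mem z hx) (hM x hx))

theorem isProj_ker_one_sub {p : X →L[ℂ] X} (hp : IsIdempotentElem p) :
    LinearMap.IsProj p.ker (1 - p) := by
  refine ⟨fun x => ?_, fun x hx => ?_⟩
  · have hpp : p (p x) = p x := DFunLike.congr_fun hp x
    simp [hpp]
  · have hpx : p x = 0 := hx
    simp [hpx]

theorem isProj_range {p : X →L[ℂ] X} (hp : IsIdempotentElem p) : LinearMap.IsProj p.range p :=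
  have h := LinearMap.IsIdempotentElem.isProj_range _
    (ContinuousLinearMap.IsIdempotentElem.toLinearMap hp)
  ⟨h.map_mem, h.map_id⟩

theorem notMem_spectrum_restrict_ker_rieszProjection [CompleteSpace X] {T : X →L[ℂ] X} {c : ℂ}
    {R : ℝ} (hT : sphere c R ⊆ resolventSet ℂ T) (hp : IsIdempotentElem (rieszProjection T c R))
    {hM : ∀ x ∈ (rieszProjection T c R).ker, T x ∈ (rieszProjection T c R).ker} {z : ℂ}
    (hz : z ∈ ball c R) : z ∉ spectrum ℂ (T.restrict hM) :=
  notMem_spectrum_restrict_of_isProj (rieszProjection T c R).isClosed_ker (isProj_ker_one_sub hp)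
    (commute_cauchyResolvent (pos_of_mem_ball hz).le hT (mem_ball.1 hz).ne)
    (algebraMap_sub_mul_cauchyResolvent_of_mem_ball hT hz)

theorem notMem_spectrum_restrict_range_rieszProjection [CompleteSpace X] {T : X →L[ℂ] X} {c : ℂ}
    {R : ℝ} (hR : 0 ≤ R) (hT : sphere c R ⊆ resolventSet ℂ T)
    (hp : IsIdempotentElem (rieszProjection T c R))
    {hM : ∀ x ∈ (rieszProjection T c R).range, T x ∈ (rieszProjection T c R).range} {z : ℂ}
    (hz : z ∉ closedBall c R) : z ∉ spectrum ℂ (T.restrict hM) := by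
  refine notMem_spectrum_restrict_of_isProj
    (ContinuousLinearMap.IsIdempotentElem.isClosed_range hp) (isProj_range hp)
    (commute_cauchyResolvent hR hT fun h => hz (sphere_subset_closedBall h)).neg_right ?_
  rw [mul_neg, algebraMap_sub_mul_cauchyResolvent_of_notMem_closedBall hR hT hz, neg_neg]

theorem isQuasinilpotent_restrict_range_rieszProjection [CompleteSpace X] {T : X →L[ℂ] X} {R : ℝ}
    (hR : 0 < R) (hT : closedBall 0 R \ {0} ⊆ resolventSet ℂ T)
    (hp : IsIdempotentElem (rieszProjection T 0 R))
    {hM : ∀ x ∈ (rieszProjection T 0 R).range, T x ∈ (rieszProjection T 0 R).range} :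
    IsQuasinilpotent (T.restrict hM) := by
  have := (ContinuousLinearMap.IsIdempotentElem.isClosed_range hp).completeSpace_coe
  refine (isQuasinilpotent_iff (T.restrict hM)).2 fun z hz => ?_
  contrapose! hz
  obtain ⟨S, hS, hSlt⟩ := exists_between (lt_min hR (norm_pos_iff.2 hz))
  rw [lt_min_iff] at hSlt
  have hannulus : closedBall 0 R \ ball 0 S ⊆ resolventSet ℂ T := fun w hw =>
    hT ⟨hw.1, by rintro rfl; exact hw.2 (mem_ball_self hS)⟩
  have hsphere : sphere 0 S ⊆ resolventSet ℂ T := fun w hw =>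
    hannulus ⟨(mem_sphere.1 hw).trans_le hSlt.1.le, fun h => h.ne (mem_sphere.1 hw)⟩
  have hRS := rieszProjection_eq_of_subset_resolventSet hS hSlt.1.le hannulus
  generalize rieszProjection T 0 R = p at *
  subst hRS
  exact notMem_spectrum_restrict_range_rieszProjection hS.le hsphere hp
    (by simpa using hSlt.2)

theorem IsGenDrazinInvertible.isPseudoFredholm [CompleteSpace X] {T : X →L[ℂ] X}
    (hT : IsGenDrazinInvertible T) : IsPseudoFredholm T := by
  rw [isGenDrazinInvertible_iff_eventually, eventually_nhdsWithin_iff,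
    nhds_basis_closedBall.eventually_iff] at hT
  obtain ⟨R, hR, hRT⟩ := hT
  have hpunctured : closedBall 0 R \ {0} ⊆ resolventSet ℂ T := fun z hz =>
    not_not.1 (hRT hz.1 hz.2)
  have hannulus : closedBall 0 R \ ball 0 (R / 2) ⊆ resolventSet ℂ T := fun z hz =>
    hpunctured ⟨hz.1, by rintro rfl; exact hz.2 (mem_ball_self (half_pos hR))⟩
  have hsphere : sphere 0 R ⊆ resolventSet ℂ T := fun z hz =>
    hannulus ⟨sphere_subset_closedBall hz, by simp [mem_sphere_zero_iff_norm.1 hz, hR.le]⟩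
  have hp := isIdempotentElem_rieszProjection (half_pos hR) (half_lt_self hR) hannulus
  obtain ⟨hN, hM⟩ := (ContinuousLinearMap.IsIdempotentElem.commute_iff hp).1
    (commute_rieszProjection hR.le hsphere).symm
  rw [Module.End.mem_invtSubmodule_iff_forall_mem_of_mem] at hN hM
  have hcompl := (LinearMap.IsIdempotentElem.isCompl
    (ContinuousLinearMap.IsIdempotentElem.toLinearMap hp)).symm
  have := (rieszProjection T 0 R).isClosed_ker.completeSpace_coe
  have hbij : Function.Bijective (T.restrict hM) := by
    simpa using (notMem_spectrum_iff_bijective (T.restrict hM) 0).1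
      (notMem_spectrum_restrict_ker_rieszProjection hsphere hp (mem_ball_self hR))
  exact ⟨_, _, hM, hN, (rieszProjection T 0 R).isClosed_ker,
    ContinuousLinearMap.IsIdempotentElem.isClosed_range hp, hcompl,
    isSemiRegular_of_bijective hbij,
    isQuasinilpotent_restrict_range_rieszProjection hR hpunctured hp⟩

theorem IsGenDrazinInvertible.hasSVEPAt [CompleteSpace X] {T : X →L[ℂ] X}
    (hT : IsGenDrazinInvertible T) : HasSVEPAt T 0 :=
  hasSVEPAt_of_frequently_injective <| Eventually.frequently <|
    ((isGenDrazinInvertible_iff_eventually T).1 hT).mono fun z hz =>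
      ((notMem_spectrum_iff_bijective T z).1 hz).1

theorem IsGenDrazinInvertible.hasSVEPAt_adj [CompleteSpace X] {T : X →L[ℂ] X}
    (hT : IsGenDrazinInvertible T) : HasSVEPAt (adj T) 0 := by
  refine hasSVEPAt_of_frequently_injective <| Eventually.frequently <|
    ((isGenDrazinInvertible_iff_eventually T).1 hT).mono fun z hz => ?_
  rw [← adj_sub_smul_id]
  exact injective_adj_of_surjective ((notMem_spectrum_iff_bijective T z).1 hz).2

theorem isGenDrazinInvertible_iff [CompleteSpace X] {T : X →L[ℂ] X} :
    IsGenDrazinInvertible T ↔ IsPseudoFredholm T ∧ HasSVEPAt T 0 ∧ HasSVEPAt (adj T) 0 :=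
  ⟨fun h => ⟨h.isPseudoFredholm, h.hasSVEPAt, h.hasSVEPAt_adj⟩,
    fun ⟨h, hSVEP, hSVEP'⟩ => h.isGenDrazinInvertible hSVEP hSVEP'⟩

end GenDrazin

end BanachOp

theorem mainTheorem8_general {X : Type*} [NormedAddCommGroup X] [NormedSpace ℂ X]
    [CompleteSpace X] (T : X →L[ℂ] X) :
    BanachOp.gDSpectrum T = BanachOp.gKSpectrum T ∪ {z | ¬ BanachOp.HasSVEPAt T z} ∪
      {z | ¬ BanachOp.HasSVEPAt (BanachOp.adj T) z} := by
  ext z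
  rw [BanachOp.gDSpectrum, Set.mem_ofPred_eq, BanachOp.isGenDrazinInvertible_iff,
    BanachOp.adj_sub_smul_id, BanachOp.hasSVEPAt_sub_smul_id_iff,
    BanachOp.hasSVEPAt_sub_smul_id_iff, zero_add, not_and_or, not_and_or, ← or_assoc]
  rfl

theorem mainTheorem8 {X : Type*} [NormedAddCommGroup X] [NormedSpace ℂ X] [CompleteSpace X]
    (T : X →L[ℂ] X) :
    (BanachOp.HasSVEP T → BanachOp.HasSVEP (BanachOp.adj T) →
      BanachOp.gDSpectrum T = BanachOp.gKSpectrum T) ∧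
    (BanachOp.IsDecomposable T → BanachOp.gDSpectrum T = BanachOp.gKSpectrum T) := by
  have hmain (hT : BanachOp.HasSVEP T) (hT' : BanachOp.HasSVEP (BanachOp.adj T)) :
      BanachOp.gDSpectrum T = BanachOp.gKSpectrum T := by
    simp [mainTheorem8_general, hT.hasSVEPAt, hT'.hasSVEPAt]
  exact ⟨hmain, fun h => hmain h.hasSVEP h.hasSVEP_adj⟩
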